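/- Let $\mathbb{A}$ be a countably infinite set, whose elements are called atoms. A \emph{set with atoms} is a set with an action of the group of all permutations of $\mathbb{A}$ such that every element $x$ has a finite support, i.e. there is a finite $\alpha \subseteq \mathbb{A}$ such that $\pi(x) = x$ for every permutation $\pi$ fixing all elements of $\alpha$. It is \emph{orbit-finite} if it has only finitely many orbits. The \emph{polynomial orbit-finite sets} are the smallest class of sets with atoms that contains the singleton $1$ (with trivial action) and $\mathbb{A}$, and is closed under binary products $X \times Y$ and binary disjoint sums $X + Y$ (with the componentwise actions). The \emph{single-use functions} are the smallest class of functions between polynomial orbit-finite sets that is closed under composition $g \circ f$, products $f \times g : X_1 \times X_2 \to Y_1 \times Y_2$ and sums $f + g : X_1 + X_2 \to Y_1 + Y_2$, and contains, for all polynomial orbit-finite $X, Y, Z$, the following functions (each being the evident function of its type): the equality test $\mathbb{A} \times \mathbb{A} \to 1 + 1$; the constant $1 \to \mathbb{A}$ with value $a$, for each $a \in \mathbb{A}$; the identity on $\mathbb{A}$; the projections $X \times Y \to X$ and $X \times Y \to Y$; $X \times Y \to Y \times X$; $(X \times Y) \times Z \to X \times (Y \times Z)$; $X \to 1 \times X$;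 the coprojections $X \to X + Y$ and $Y \to X + Y$; $X + Y \to Y + X$; $(X + Y) + Z \to X + (Y + Z)$; the merge $X + X \to X$; and the distributivity map $X \times (Y + Z) \to X \times Y + X \times Z$. Theorem. For all polynomial orbit-finite sets $X$ and $Y$, the set $X \multimap Y$ of all single-use functions from $X$ to $Y$, with the action $\pi(f) = \pi \circ f \circ \pi^{-1}$ of the permutations of $\mathbb{A}$, is orbit-finite. -/

import Mathlib

universe u

/-- The closure construction generating the polynomial orbit-finite sets: the atomless singleton,
the set of atoms, binary products and binary disjoint sums. -/
inductive POF : Type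
  | one : POF
  | atom : POF
  | prod : POF → POF → POF
  | sum : POF → POF → POF

namespace POF

/-- The underlying set of a polynomial orbit-finite set over the set of atoms `𝔸`. -/
def El (𝔸 : Type u) : POF → Type u
  | one => PUnit
  | atom => 𝔸
  | prod X Y => El 𝔸 X × El 𝔸 Y
  | sum X Y => El 𝔸 X ⊕ El 𝔸 Y

variable {𝔸 : Type u}

/-- Atom permutations act trivially on the singleton, by application on atoms, and componentwise
on products and disjoint sums. -/
def act (π : Equiv.Perm 𝔸) : (X : POF) → El 𝔸 X → El 𝔸 X
  | one => fun x => x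
  | atom => fun a => π a
  | prod X Y => Prod.map (act π X) (act π Y)
  | sum X Y => Sum.map (act π X) (act π Y)

theorem act_one : ∀ (X : POF) (x : El 𝔸 X), act 1 X x = x
  | one, _ => rfl
  | atom, _ => rfl
  | prod X Y, (x, y) => Prod.ext (act_one X x) (act_one Y y)
  | sum X _, Sum.inl x => congrArg Sum.inl (act_one X x)
  | sum _ Y, Sum.inr y => congrArg Sum.inr (act_one Y y)

theorem act_mul (π σ : Equiv.Perm 𝔸) :
    ∀ (X : POF) (x : El 𝔸 X), act (π * σ) X x = act π X (act σ X x)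
  | one, _ => rfl
  | atom, _ => rfl
  | prod X Y, (x, y) => Prod.ext (act_mul π σ X x) (act_mul π σ Y y)
  | sum X _, Sum.inl x => congrArg Sum.inl (act_mul π σ X x)
  | sum _ Y, Sum.inr y => congrArg Sum.inr (act_mul π σ Y y)

instance (X : POF) : MulAction (Equiv.Perm 𝔸) (El 𝔸 X) where
  smul π x := act π X x
  one_smul := act_one X
  mul_smul π σ x := act_mul π σ X x

/-- `f × g : X₁ × X₂ → Y₁ × Y₂`. -/
def prodMap {X₁ X₂ Y₁ Y₂ : POF} (f : El 𝔸 X₁ → El 𝔸 Y₁) (g : El 𝔸 X₂ → El 𝔸 Y₂) :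
    El 𝔸 (prod X₁ X₂) → El 𝔸 (prod Y₁ Y₂)
  | (x₁, x₂) => (f x₁, g x₂)

/-- `f + g : X₁ + X₂ → Y₁ + Y₂`. -/
def sumMap {X₁ X₂ Y₁ Y₂ : POF} (f : El 𝔸 X₁ → El 𝔸 Y₁) (g : El 𝔸 X₂ → El 𝔸 Y₂) :
    El 𝔸 (sum X₁ X₂) → El 𝔸 (sum Y₁ Y₂)
  | Sum.inl x => Sum.inl (f x)
  | Sum.inr x => Sum.inr (g x)

open Classical in
/-- `eq : 𝔸 × 𝔸 → 1 + 1`; the left summand represents "true". -/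
noncomputable def eqFun : El 𝔸 (prod atom atom) → El 𝔸 (sum one one) :=
  fun p : 𝔸 × 𝔸 => if p.1 = p.2 then Sum.inl PUnit.unit else Sum.inr PUnit.unit

/-- `const_a : 1 → 𝔸`. -/
def constFun (a : 𝔸) : El 𝔸 one → El 𝔸 atom := fun _ => a

/-- `proj₁ : X × Y → X`. -/
def proj₁Fun (X Y : POF) : El 𝔸 (prod X Y) → El 𝔸 X
  | (x, _) => x

/-- `proj₂ : X × Y → Y`. -/
def proj₂Fun (X Y : POF) : El 𝔸 (prod X Y) → El 𝔸 Y
  | (_, y) => y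

/-- `sym : X × Y → Y × X`. -/
def symFun (X Y : POF) : El 𝔸 (prod X Y) → El 𝔸 (prod Y X)
  | (x, y) => (y, x)

/-- `assoc : (X × Y) × Z → X × (Y × Z)`. -/
def assocFun (X Y Z : POF) : El 𝔸 (prod (prod X Y) Z) → El 𝔸 (prod X (prod Y Z))
  | ((x, y), z) => (x, (y, z))

/-- `leftI : X → 1 × X`. -/
def leftIFun (X : POF) : El 𝔸 X → El 𝔸 (prod one X) := fun x => (PUnit.unit, x)

/-- `coproj₁ : X → X + Y`. -/
def coproj₁Fun (X Y : POF) : El 𝔸 X → El 𝔸 (sum X Y) := fun x => Sum.inl x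

/-- `coproj₂ : Y → X + Y`. -/
def coproj₂Fun (X Y : POF) : El 𝔸 Y → El 𝔸 (sum X Y) := fun y => Sum.inr y

/-- `cosym : X + Y → Y + X`. -/
def cosymFun (X Y : POF) : El 𝔸 (sum X Y) → El 𝔸 (sum Y X)
  | Sum.inl x => Sum.inr x
  | Sum.inr y => Sum.inl y

/-- `coassoc : (X + Y) + Z → X + (Y + Z)`. -/
def coassocFun (X Y Z : POF) : El 𝔸 (sum (sum X Y) Z) → El 𝔸 (sum X (sum Y Z))
  | Sum.inl (Sum.inl x) => Sum.inl x
  | Sum.inl (Sum.inr y) => Sum.inr (Sum.inl y)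
  | Sum.inr z => Sum.inr (Sum.inr z)

/-- `merge : X + X → X`. -/
def mergeFun (X : POF) : El 𝔸 (sum X X) → El 𝔸 X
  | Sum.inl x => x
  | Sum.inr x => x

/-- `distr : X × (Y + Z) → X × Y + X × Z`. -/
def distrFun (X Y Z : POF) : El 𝔸 (prod X (sum Y Z)) → El 𝔸 (sum (prod X Y) (prod X Z))
  | (x, Sum.inl y) => Sum.inl (x, y)
  | (x, Sum.inr z) => Sum.inr (x, z)

/-- The class of single-use functions: the smallest class of functions between polynomial
orbit-finite sets containing the basic functions and closed under `∘`, `×` and `+`. -/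
inductive IsSingleUse {𝔸 : Type u} : ∀ {X Y : POF}, (El 𝔸 X → El 𝔸 Y) → Prop
  -- combinators
  | comp {X Y Z : POF} {f : El 𝔸 X → El 𝔸 Y} {g : El 𝔸 Y → El 𝔸 Z} :
      IsSingleUse f → IsSingleUse g → IsSingleUse (g ∘ f)
  | prodMap {X₁ X₂ Y₁ Y₂ : POF} {f : El 𝔸 X₁ → El 𝔸 Y₁} {g : El 𝔸 X₂ → El 𝔸 Y₂} :
      IsSingleUse f → IsSingleUse g → IsSingleUse (prodMap f g)
  | sumMap {X₁ X₂ Y₁ Y₂ : POF} {f : El 𝔸 X₁ → El 𝔸 Y₁} {g : El 𝔸 X₂ → El 𝔸 Y₂} :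
      IsSingleUse f → IsSingleUse g → IsSingleUse (sumMap f g)
  -- functions about atoms
  | eq : IsSingleUse eqFun
  | const (a : 𝔸) : IsSingleUse (constFun a)
  | id : IsSingleUse (X := atom) (Y := atom) (fun a => a)
  -- functions about products
  | proj₁ (X Y : POF) : IsSingleUse (proj₁Fun X Y)
  | proj₂ (X Y : POF) : IsSingleUse (proj₂Fun X Y)
  | sym (X Y : POF) : IsSingleUse (symFun X Y)
  | assoc (X Y Z : POF) : IsSingleUse (assocFun X Y Z)
  | leftI (X : POF) : IsSingleUse (leftIFun X)
  -- functions about disjoint sums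
  | coproj₁ (X Y : POF) : IsSingleUse (coproj₁Fun X Y)
  | coproj₂ (X Y : POF) : IsSingleUse (coproj₂Fun X Y)
  | cosym (X Y : POF) : IsSingleUse (cosymFun X Y)
  | coassoc (X Y Z : POF) : IsSingleUse (coassocFun X Y Z)
  | merge (X : POF) : IsSingleUse (mergeFun X)
  -- distributivity
  | distr (X Y Z : POF) : IsSingleUse (distrFun X Y Z)

/-- The action of atom permutations on functions, `π(f) = π ∘ f ∘ π⁻¹`. -/
def conj (π : Equiv.Perm 𝔸) {X Y : POF} (f : El 𝔸 X → El 𝔸 Y) : El 𝔸 X → El 𝔸 Y :=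
  fun x => π • f (π⁻¹ • x)

theorem IsSingleUse.conj_of_equivariant {X Y : POF} {f : El 𝔸 X → El 𝔸 Y}
    (hf : IsSingleUse f) (π : Equiv.Perm 𝔸) (h : ∀ x, f (act π X x) = act π Y (f x)) :
    IsSingleUse (conj π f) := by
  have : conj π f = f := by
    funext x
    have h' := h (π⁻¹ • x)
    change f (π • π⁻¹ • x) = π • f (π⁻¹ • x) at h'
    rw [smul_inv_smul] at h'
    exact h'.symm
  rwa [this]

/-- Atom permutations map single-use functions to single-use functions. -/
theorem IsSingleUse.conj (π : Equiv.Perm 𝔸) {X Y : POF} {f : El 𝔸 X → El 𝔸 Y}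
    (hf : IsSingleUse f) : IsSingleUse (POF.conj π f) := by
  induction hf with
  | @comp X Y Z f g _ _ ihf ihg =>
    have : POF.conj π (g ∘ f) = POF.conj π g ∘ POF.conj π f := by
      funext x; simp [POF.conj]
    rw [this]; exact ihf.comp ihg
  | prodMap _ _ ihf ihg => exact ihf.prodMap ihg
  | @sumMap X₁ X₂ Y₁ Y₂ f g _ _ ihf ihg =>
    have : POF.conj π (POF.sumMap f g) = POF.sumMap (POF.conj π f) (POF.conj π g) := by
      funext x; rcases x with x | x <;> rfl
    rw [this]; exact ihf.sumMap ihg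
  | eq =>
    refine IsSingleUse.eq.conj_of_equivariant π ?_
    rintro ⟨a, b⟩
    classical
    change 𝔸 at a b
    change (if π a = π b then Sum.inl PUnit.unit else Sum.inr PUnit.unit) =
      Sum.map _ _ (if a = b then Sum.inl PUnit.unit else Sum.inr PUnit.unit)
    by_cases h : a = b
    · subst h; rw [if_pos rfl, if_pos rfl]; rfl
    · rw [if_neg h, if_neg (fun h' => h (π.injective h'))]; rfl
  | const a => exact .const (π a)
  | id => exact IsSingleUse.id.conj_of_equivariant π fun _ => rfl
  | proj₁ X Y => exact (IsSingleUse.proj₁ X Y).conj_of_equivariant π fun _ => rfl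
  | proj₂ X Y => exact (IsSingleUse.proj₂ X Y).conj_of_equivariant π fun _ => rfl
  | sym X Y => exact (IsSingleUse.sym X Y).conj_of_equivariant π fun _ => rfl
  | assoc X Y Z => exact (IsSingleUse.assoc X Y Z).conj_of_equivariant π fun _ => rfl
  | leftI X => exact (IsSingleUse.leftI X).conj_of_equivariant π fun _ => rfl
  | coproj₁ X Y => exact (IsSingleUse.coproj₁ X Y).conj_of_equivariant π fun _ => rfl
  | coproj₂ X Y => exact (IsSingleUse.coproj₂ X Y).conj_of_equivariant π fun _ => rfl
  | cosym X Y =>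
    exact (IsSingleUse.cosym X Y).conj_of_equivariant π (by rintro (x | x) <;> rfl)
  | coassoc X Y Z =>
    exact (IsSingleUse.coassoc X Y Z).conj_of_equivariant π (by rintro ((x | x) | x) <;> rfl)
  | merge X =>
    exact (IsSingleUse.merge X).conj_of_equivariant π (by rintro (x | x) <;> rfl)
  | distr X Y Z =>
    exact (IsSingleUse.distr X Y Z).conj_of_equivariant π (by rintro ⟨x, y | y⟩ <;> rfl)

/-- The set `X ⊸ Y` of all single-use functions from `X` to `Y`. -/
def SingleUseFun (𝔸 : Type u) (X Y : POF) : Type u :=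
  {f : El 𝔸 X → El 𝔸 Y // IsSingleUse f}

/-- Atom permutations act on `X ⊸ Y` by `π(f) = π ∘ f ∘ π⁻¹`. -/
instance (X Y : POF) : MulAction (Equiv.Perm 𝔸) (SingleUseFun 𝔸 X Y) where
  smul π f := ⟨conj π f.1, f.2.conj π⟩
  one_smul f := Subtype.ext <| by
    funext x
    change (1 : Equiv.Perm 𝔸) • f.1 ((1 : Equiv.Perm 𝔸)⁻¹ • x) = f.1 x
    simp
  mul_smul π σ f := Subtype.ext <| by
    funext x
    change (π * σ) • f.1 ((π * σ)⁻¹ • x) = π • σ • f.1 (σ⁻¹ • π⁻¹ • x)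
    simp [mul_smul]

end POF

/-- A set with atoms: a set with an action of the atom permutations such that every element is
supported by some finite set of atoms. -/
def IsSetWithAtoms (𝔸 : Type*) (S : Type*) [MulAction (Equiv.Perm 𝔸) S] : Prop :=
  ∀ x : S, ∃ α : Finset 𝔸, MulAction.Supports (Equiv.Perm 𝔸) (α : Set 𝔸) x

/-- An orbit-finite set: a set with atoms that has only finitely many orbits. -/
def IsOrbitFinite (𝔸 : Type*) (S : Type*) [MulAction (Equiv.Perm 𝔸) S] : Prop :=
  IsSetWithAtoms 𝔸 S ∧ Finite (MulAction.orbitRel.Quotient (Equiv.Perm 𝔸) S)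

/-! A finitely supported function, say from atoms to 1 + 1, may need an arbitrarily large support.
Single use prevents this: each comparison consumes an atom, so only boundedly many can be made. To
make this precise, feed a single-use function a term in which each variable occurs at most once. By
induction on its derivation, the result is computed by a decision tree in which every query
involving variables uses up at least one of them, and whose leaves are linear terms in the remaining
ones (`IsSingleUse.decisionTree`). The depth is at most the number of atom positions of X, so the
constants in the tree, which support the function, are bounded in number. Finitely many shapes of
input cover X, giving a uniform bound N (`exists_card_support_le`). A permutation then moves the
support of any function into one fixed set W of N atoms, and W supports only finitely many functions
(`finite_setOf_supports`). These represent all orbits. -/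

namespace POF

/-- The functorial action of `El` on maps between atom sets. -/
def emap {α : Type*} {β : Type*} (f : α → β) : (X : POF) → El α X → El β X
  | one => fun _ => PUnit.unit
  | atom => fun a => f a
  | prod X Y => Prod.map (emap f X) (emap f Y)
  | sum X Y => Sum.map (emap f X) (emap f Y)

theorem emap_emap {α β γ : Type*} (f : α → β) (g : β → γ) :
    ∀ (X : POF) (x : El α X), emap g X (emap f X x) = emap (g ∘ f) X x
  | one, _ => rfl
  | atom, _ => rfl
  | prod X Y, (x, y) => Prod.ext (emap_emap f g X x) (emap_emap f g Y y)
  | sum X _, Sum.inl x => congrArg Sum.inl (emap_emap f g X x)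
  | sum _ Y, Sum.inr y => congrArg Sum.inr (emap_emap f g Y y)

theorem smul_eq_emap {𝔸 : Type*} (π : Equiv.Perm 𝔸) :
    ∀ (X : POF) (x : El 𝔸 X), π • x = emap π X x
  | one, _ => rfl
  | atom, _ => rfl
  | prod X Y, (x, y) => Prod.ext (smul_eq_emap π X x) (smul_eq_emap π Y y)
  | sum X _, Sum.inl x => congrArg Sum.inl (smul_eq_emap π X x)
  | sum _ Y, Sum.inr y => congrArg Sum.inr (smul_eq_emap π Y y)

theorem finite_el {α : Type*} [Finite α] : ∀ X : POF, Finite (El α X)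
  | one => inferInstanceAs (Finite PUnit)
  | atom => inferInstanceAs (Finite α)
  | prod X Y =>
    have := finite_el (α := α) X
    have := finite_el (α := α) Y
    inferInstanceAs (Finite (El α X × El α Y))
  | sum X Y =>
    have := finite_el (α := α) X
    have := finite_el (α := α) Y
    inferInstanceAs (Finite (El α X ⊕ El α Y))

/-- An upper bound on the number of atoms in an element of a polynomial orbit-finite set. -/
def size : POF → ℕ
  | one => 0
  | atom => 1
  | prod X Y => size X + size Y
  | sum X Y => size X + size Y

/-! ### Linear terms and decision trees -/

/-- The multiset of variables of a term, i.e. of an element over the atom set `V ⊕ 𝔸` that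
consists of variables and constants. -/
def vars {V 𝔸 : Type*} : (X : POF) → El (V ⊕ 𝔸) X → Multiset V
  | one => fun _ => 0
  | atom => Sum.elim (fun v => {v}) (fun _ => 0)
  | prod X Y => fun p => vars X p.1 + vars Y p.2
  | sum X Y => Sum.elim (vars X) (vars Y)

/-- The value of a term under a valuation of its variables. -/
def eval {V 𝔸 : Type*} (ρ : V → 𝔸) (X : POF) : El (V ⊕ 𝔸) X → El 𝔸 X :=
  emap (Sum.elim ρ id) X

/-- The constants of the term form the support, which therefore does not depend on the valuation. -/
theorem exists_support_eval {V 𝔸 : Type*} :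
    ∀ (X : POF) (t : El (V ⊕ 𝔸) X), ∃ S : Finset 𝔸, S.card ≤ size X ∧
      ∀ (π : Equiv.Perm 𝔸) (ρ : V → 𝔸), (∀ a ∈ S, π a = a) →
        emap π X (eval ρ X t) = eval (π ∘ ρ) X t
  | one, _ => ⟨∅, by simp, fun _ _ _ => rfl⟩
  | atom, Sum.inl _ => ⟨∅, by simp, fun _ _ _ => rfl⟩
  | atom, Sum.inr c => ⟨{c}, by simp [size], fun π ρ h => h c (by simp)⟩
  | prod X Y, (x, y) => by
    classical
    obtain ⟨S, hS, hx⟩ := exists_support_eval X x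
    obtain ⟨T, hT, hy⟩ := exists_support_eval Y y
    refine ⟨S ∪ T, (Finset.card_union_le S T).trans (add_le_add hS hT), fun π ρ h => ?_⟩
    exact Prod.ext (hx π ρ fun a ha => h a (Finset.mem_union_left _ ha))
      (hy π ρ fun a ha => h a (Finset.mem_union_right _ ha))
  | sum X Y, Sum.inl x => by
    obtain ⟨S, hS, hx⟩ := exists_support_eval X x
    exact ⟨S, hS.trans (Nat.le_add_right _ _), fun π ρ h => congrArg Sum.inl (hx π ρ h)⟩
  | sum X Y, Sum.inr y => by
    obtain ⟨S, hS, hy⟩ := exists_support_eval Y y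
    exact ⟨S, hS.trans (Nat.le_add_left _ _), fun π ρ h => congrArg Sum.inr (hy π ρ h)⟩

/-- Decision trees: a leaf outputs a term that is linear in the available variables, and a
query compares two variables or constants and makes at least one variable unavailable. -/
inductive DecisionTree {V 𝔸 : Type*} {Y : POF} : Finset V → ((V → 𝔸) → El 𝔸 Y) → Prop
  | leaf {s : Finset V} (t : El (V ⊕ 𝔸) Y) (h : vars Y t ≤ s.val) :
      DecisionTree s (fun ρ => eval ρ Y t)
  | query {s s' : Finset V} (p q : V ⊕ 𝔸) {F G H : (V → 𝔸) → El 𝔸 Y} (h : s' ⊂ s)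
      (hF : DecisionTree s' F) (hG : DecisionTree s' G)
      (hpos : ∀ ρ, Sum.elim ρ id p = Sum.elim ρ id q → H ρ = F ρ)
      (hneg : ∀ ρ, Sum.elim ρ id p ≠ Sum.elim ρ id q → H ρ = G ρ) : DecisionTree s H

namespace DecisionTree

variable {V 𝔸 : Type*} {X Y Z : POF}

theorem mono {s s' : Finset V} {F : (V → 𝔸) → El 𝔸 Y} (hF : DecisionTree s F) (h : s ⊆ s') :
    DecisionTree s' F := by
  induction hF with
  | leaf t ht => exact .leaf t (ht.trans (Finset.val_le_iff.2 h))
  | query p q hs hF hG hpos hneg => exact .query p q (hs.trans_subset h) hF hG hpos hneg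

/-- Leaves are linear terms in the variables still available, so a tree for `g` can be grafted onto
each of them. -/
theorem bind {s : Finset V} {F : (V → 𝔸) → El 𝔸 X} {g : El 𝔸 X → El 𝔸 Y}
    (hF : DecisionTree s F)
    (hg : ∀ (s : Finset V) (t : El (V ⊕ 𝔸) X), vars X t ≤ s.val →
      DecisionTree s (fun ρ => g (eval ρ X t))) :
    DecisionTree s (fun ρ => g (F ρ)) := by
  induction hF with
  | leaf t ht => exact hg _ t ht
  | query p q hs _ _ hpos hneg ihF ihG =>
    exact .query p q hs ihF ihG (fun ρ h => congrArg g (hpos ρ h))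
      (fun ρ h => congrArg g (hneg ρ h))

/-- The second tree is run at each leaf of the first. Disjointness ensures that a query in either
tree strictly shrinks the union. -/
theorem pair [DecidableEq V] {s s' : Finset V} {F : (V → 𝔸) → El 𝔸 X} {G : (V → 𝔸) → El 𝔸 Y}
    (hF : DecisionTree s F) (hG : DecisionTree s' G) (hd : Disjoint s s') :
    DecisionTree (Y := prod X Y) (s ∪ s') (fun ρ => (F ρ, G ρ)) := by
  induction hF with
  | @leaf s t ht =>
    induction hG with
    | @leaf s' t' ht' =>
      refine .leaf (Y := prod X Y) (t, t') ?_
      rw [← Finset.disjUnion_eq_union _ _ hd]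
      exact add_le_add ht ht'
    | @query s' s'' p q _ _ _ hs _ _ hpos hneg ihF ihG =>
      have hd' := hd.mono_right hs.subset
      refine .query p q ?_ (ihF hd') (ihG hd') (fun ρ h => Prod.ext rfl (hpos ρ h))
        (fun ρ h => Prod.ext rfl (hneg ρ h))
      rw [← Finset.disjUnion_eq_union _ _ hd, ← Finset.disjUnion_eq_union _ _ hd',
        ← Finset.val_lt_iff]
      exact add_lt_add_right (Finset.val_lt_iff.2 hs) _
  | @query s s'' p q _ _ _ hs _ _ hpos hneg ihF ihG =>
    have hd' := hd.mono_left hs.subset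
    refine .query p q ?_ (ihF hd') (ihG hd') (fun ρ h => Prod.ext (hpos ρ h) rfl)
      (fun ρ h => Prod.ext (hneg ρ h) rfl)
    rw [← Finset.disjUnion_eq_union _ _ hd, ← Finset.disjUnion_eq_union _ _ hd',
      ← Finset.val_lt_iff]
    exact add_lt_add_left (Finset.val_lt_iff.2 hs) _

/-- The support collects all constants in the tree. A query adds at most two to those of its
subtrees, so the count obeys n ↦ 2n + 2; adding 2 to it turns this into pure doubling. -/
theorem exists_support {s : Finset V} {F : (V → 𝔸) → El 𝔸 Y} (hF : DecisionTree s F) :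
    ∃ S : Finset 𝔸, S.card + 2 ≤ 2 ^ s.card * (size Y + 2) ∧
      ∀ (π : Equiv.Perm 𝔸) (ρ : V → 𝔸), (∀ a ∈ S, π a = a) →
        emap π Y (F ρ) = F (π ∘ ρ) := by
  classical
  induction hF with
  | leaf t _ =>
    obtain ⟨S, hS, h⟩ := exists_support_eval Y t
    exact ⟨S, (Nat.add_le_add_right hS 2).trans (Nat.le_mul_of_pos_left _ (by positivity)), h⟩
  | @query s s' p q F G H hs _ _ hpos hneg ihF ihG =>
    obtain ⟨S, hS, hF⟩ := ihF
    obtain ⟨T, hT, hG⟩ := ihG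
    have key : ∀ p : V ⊕ 𝔸, ∃ C : Finset 𝔸, C.card ≤ 1 ∧
        ∀ (π : Equiv.Perm 𝔸) (ρ : V → 𝔸), (∀ a ∈ C, π a = a) →
          π (Sum.elim ρ id p) = Sum.elim (π ∘ ρ) id p :=
      exists_support_eval (V := V) atom
    obtain ⟨C, hC, hp⟩ := key p
    obtain ⟨D, hD, hq⟩ := key q
    refine ⟨(S ∪ T) ∪ (C ∪ D), ?_, fun π ρ hπ => ?_⟩
    · have h₁ := Finset.card_union_le (S ∪ T) (C ∪ D)
      have h₂ := Finset.card_union_le S T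
      have h₃ := Finset.card_union_le C D
      have h₄ : 2 ^ (s'.card + 1) * (size Y + 2) ≤ 2 ^ s.card * (size Y + 2) :=
        Nat.mul_le_mul_right _ (Nat.pow_le_pow_right (by norm_num) (Finset.card_lt_card hs))
      rw [pow_succ, mul_assoc, mul_left_comm] at h₄
      omega
    · simp only [Finset.mem_union] at hπ
      have hp' := hp π ρ fun a ha => hπ a (.inr (.inl ha))
      have hq' := hq π ρ fun a ha => hπ a (.inr (.inr ha))
      by_cases h : Sum.elim ρ id p = Sum.elim ρ id q
      · rw [hpos ρ h, hpos (π ∘ ρ) (by rw [← hp', ← hq', h])]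
        exact hF π ρ fun a ha => hπ a (.inl (.inl ha))
      · rw [hneg ρ h, hneg (π ∘ ρ) (by rw [← hp', ← hq']; exact π.injective.ne h)]
        exact hG π ρ fun a ha => hπ a (.inl (.inr ha))

end DecisionTree

/-- Single-use functions, applied to linear terms, are computed by decision trees. -/
theorem IsSingleUse.decisionTree {V 𝔸 : Type*} {X Y : POF} {f : El 𝔸 X → El 𝔸 Y}
    (hf : IsSingleUse f) (s : Finset V) (t : El (V ⊕ 𝔸) X) (ht : vars X t ≤ s.val) :
    DecisionTree s (fun ρ => f (eval ρ X t)) := by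
  classical
  induction hf generalizing s with
  | comp _ _ ihf ihg => exact (ihf s t ht).bind ihg
  | @prodMap X₁ X₂ Y₁ Y₂ f g _ _ ihf ihg =>
    obtain ⟨t₁, t₂⟩ := t
    change vars X₁ t₁ + vars X₂ t₂ ≤ s.val at ht
    have hnd := Multiset.nodup_of_le ht s.nodup
    rw [Multiset.nodup_add] at hnd
    -- Linearity of the pair makes the variable sets of its two components disjoint.
    refine DecisionTree.mono (s := ⟨_, hnd.1⟩ ∪ ⟨_, hnd.2.1⟩)
      ((ihf _ t₁ le_rfl).pair (ihg _ t₂ le_rfl) ?_) ?_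
    · exact Finset.disjoint_val.1 hnd.2.2
    · exact Finset.union_subset
        (Finset.val_le_iff.1 ((Multiset.le_add_right _ _).trans ht))
        (Finset.val_le_iff.1 ((Multiset.le_add_left _ _).trans ht))
  | @sumMap X₁ X₂ Y₁ Y₂ f g _ _ ihf ihg =>
    rcases t with t | t
    · exact (ihf s t ht).bind (g := Sum.inl) (Y := sum Y₁ Y₂)
        fun s t ht => .leaf (Y := sum Y₁ Y₂) (Sum.inl t) ht
    · exact (ihg s t ht).bind (g := Sum.inr) (Y := sum Y₁ Y₂)
        fun s t ht => .leaf (Y := sum Y₁ Y₂) (Sum.inr t) ht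
  | eq =>
    obtain ⟨p, q⟩ := t
    change V ⊕ 𝔸 at p q
    let yes : El (V ⊕ 𝔸) (sum one one) := Sum.inl PUnit.unit
    let no : El (V ⊕ 𝔸) (sum one one) := Sum.inr PUnit.unit
    have of_ssubset (s' : Finset V) (hs : s' ⊂ s) :
        DecisionTree s (fun ρ => eqFun (eval ρ (prod atom atom) (p, q))) :=
      .query p q hs (.leaf yes (Multiset.zero_le _)) (.leaf no (Multiset.zero_le _))
        (fun ρ h => if_pos h) (fun ρ h => if_neg h)
    rcases p with v | c
    · exact of_ssubset _ (Finset.erase_ssubset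
        (Multiset.singleton_le.1 ((Multiset.le_add_right _ _).trans ht) : v ∈ s))
    · rcases q with v | d
      · exact of_ssubset _ (Finset.erase_ssubset
          (Multiset.singleton_le.1 ((Multiset.le_add_left _ _).trans ht) : v ∈ s))
      -- Comparing two constants consumes no variable, so the outcome is decided now, without a
      -- query.
      · by_cases h : c = d
        · convert DecisionTree.leaf (𝔸 := 𝔸) yes (Multiset.zero_le s.val) using 2
          exact if_pos h
        · convert DecisionTree.leaf (𝔸 := 𝔸) no (Multiset.zero_le s.val) using 2
          exact if_neg h
  | const a => exact .leaf (Y := atom) (Sum.inr a) (Multiset.zero_le _)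
  | id => exact .leaf (Y := atom) t ht
  | proj₁ X Y => exact .leaf t.1 ((Multiset.le_add_right _ _).trans ht)
  | proj₂ X Y => exact .leaf t.2 ((Multiset.le_add_left _ _).trans ht)
  | sym X Y =>
    exact .leaf (Y := prod Y X) (t.2, t.1) ((add_comm (vars Y t.2) (vars X t.1)).trans_le ht)
  | assoc X Y Z =>
    exact .leaf (Y := prod X (prod Y Z)) (t.1.1, (t.1.2, t.2))
      ((add_assoc (vars X t.1.1) (vars Y t.1.2) (vars Z t.2)).symm.trans_le ht)
  | leftI X => exact .leaf (Y := prod one X) (PUnit.unit, t) ((zero_add (vars X t)).trans_le ht)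
  | coproj₁ X Y => exact .leaf (Y := sum X Y) (Sum.inl t) ht
  | coproj₂ X Y => exact .leaf (Y := sum X Y) (Sum.inr t) ht
  | cosym X Y =>
    rcases t with t | t
    · exact .leaf (Y := sum Y X) (Sum.inr t) ht
    · exact .leaf (Y := sum Y X) (Sum.inl t) ht
  | coassoc X Y Z =>
    rcases t with (t | t) | t
    · exact .leaf (Y := sum X (sum Y Z)) (Sum.inl t) ht
    · exact .leaf (Y := sum X (sum Y Z)) (Sum.inr (Sum.inl t)) ht
    · exact .leaf (Y := sum X (sum Y Z)) (Sum.inr (Sum.inr t)) ht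
  | merge X =>
    rcases t with t | t
    · exact .leaf (Y := X) t ht
    · exact .leaf (Y := X) t ht
  | distr X Y Z =>
    rcases t with ⟨x, t | t⟩
    · exact .leaf (Y := sum (prod X Y) (prod X Z)) (Sum.inl (x, t)) ht
    · exact .leaf (Y := sum (prod X Y) (prod X Z)) (Sum.inr (x, t)) ht

/-! ### Generic terms and the uniform support bound -/

/-- The positions of atoms in the type expression of a polynomial orbit-finite set. -/
def Pos : POF → Type
  | one => Empty
  | atom => Unit
  | prod X Y => Pos X ⊕ Pos Y
  | sum X Y => Pos X ⊕ Pos Y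

instance instFintypePos : (X : POF) → Fintype (Pos X)
  | one => inferInstanceAs (Fintype Empty)
  | atom => inferInstanceAs (Fintype Unit)
  | prod X Y =>
    letI := instFintypePos X
    letI := instFintypePos Y
    inferInstanceAs (Fintype (Pos X ⊕ Pos Y))
  | sum X Y =>
    letI := instFintypePos X
    letI := instFintypePos Y
    inferInstanceAs (Fintype (Pos X ⊕ Pos Y))

/-- The linear term of a given shape whose variables are the positions. -/
def generic (𝔸 : Type*) : (X : POF) → El Unit X → El (Pos X ⊕ 𝔸) X
  | one => fun _ => PUnit.unit
  | atom => fun _ => Sum.inl ()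
  | prod X Y => fun p => (emap (Sum.map Sum.inl id) X (generic 𝔸 X p.1),
      emap (Sum.map Sum.inr id) Y (generic 𝔸 Y p.2))
  | sum X Y => Sum.map (fun x => emap (Sum.map Sum.inl id) X (generic 𝔸 X x))
      (fun y => emap (Sum.map Sum.inr id) Y (generic 𝔸 Y y))

theorem vars_emap {V W 𝔸 : Type*} (f : V → W) :
    ∀ (X : POF) (t : El (V ⊕ 𝔸) X), vars X (emap (Sum.map f id) X t) = (vars X t).map f
  | one, _ => rfl
  | atom, Sum.inl _ => rfl
  | atom, Sum.inr _ => rfl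
  | prod X Y, (x, y) => (congrArg₂ (· + ·) (vars_emap f X x) (vars_emap f Y y)).trans
      (Multiset.map_add f _ _).symm
  | sum X _, Sum.inl x => vars_emap f X x
  | sum _ Y, Sum.inr y => vars_emap f Y y

theorem nodup_vars_generic (𝔸 : Type*) :
    ∀ (X : POF) (x : El Unit X), (vars X (generic 𝔸 X x)).Nodup
  | one, _ => Multiset.nodup_zero
  | atom, _ => Multiset.nodup_singleton _
  | prod X Y, (x, y) => by
    have h : ((vars X (generic 𝔸 X x)).map (Sum.inl : _ → Pos X ⊕ Pos Y) +
        (vars Y (generic 𝔸 Y y)).map Sum.inr).Nodup := by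
      refine Multiset.nodup_add.2 ⟨(nodup_vars_generic 𝔸 X x).map Sum.inl_injective,
        (nodup_vars_generic 𝔸 Y y).map Sum.inr_injective, ?_⟩
      rw [Multiset.disjoint_map_map]
      exact fun _ _ _ _ h => Sum.inl_ne_inr h
    rw [← vars_emap, ← vars_emap] at h
    exact h
  | sum X Y, Sum.inl x => by
    have h := (nodup_vars_generic 𝔸 X x).map (Sum.inl_injective (β := Pos Y))
    rw [← vars_emap] at h
    exact h
  | sum X Y, Sum.inr y => by
    have h := (nodup_vars_generic 𝔸 Y y).map (Sum.inr_injective (α := Pos X))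
    rw [← vars_emap] at h
    exact h

theorem eval_emap {V W 𝔸 : Type*} (f : V → W) (ρ : W → 𝔸) (X : POF) (t : El (V ⊕ 𝔸) X) :
    eval ρ X (emap (Sum.map f id) X t) = eval (ρ ∘ f) X t := by
  rw [eval, emap_emap, Sum.elim_comp_map]
  rfl

/-- Every element is an instance of the generic term of its shape. One valuation serves all `g`, so
an element and its images under permutations come from the same term. -/
theorem exists_eval_generic {𝔸 : Type*} [Nonempty 𝔸] :
    ∀ (X : POF) (x : El 𝔸 X), ∃ ρ : Pos X → 𝔸, ∀ g : 𝔸 → 𝔸,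
      eval (g ∘ ρ) X (generic 𝔸 X (emap (fun _ => ()) X x)) = emap g X x
  | one, _ => ⟨Empty.elim, fun _ => rfl⟩
  | atom, a => ⟨fun _ => a, fun _ => rfl⟩
  | prod X Y, (x, y) => by
    obtain ⟨ρ, hx⟩ := exists_eval_generic X x
    obtain ⟨σ, hy⟩ := exists_eval_generic Y y
    exact ⟨Sum.elim ρ σ, fun g => Prod.ext ((eval_emap Sum.inl _ _ _).trans (hx g))
      ((eval_emap Sum.inr _ _ _).trans (hy g))⟩
  | sum X Y, Sum.inl x => by
    obtain ⟨ρ, hx⟩ := exists_eval_generic X x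
    -- Positions in the absent summand do not occur in the term; any atom will do.
    exact ⟨Sum.elim ρ fun _ => Classical.arbitrary 𝔸,
      fun g => congrArg Sum.inl ((eval_emap Sum.inl _ _ _).trans (hx g))⟩
  | sum X Y, Sum.inr y => by
    obtain ⟨σ, hy⟩ := exists_eval_generic Y y
    exact ⟨Sum.elim (fun _ => Classical.arbitrary 𝔸) σ,
      fun g => congrArg Sum.inr ((eval_emap Sum.inr _ _ _).trans (hy g))⟩

/-- Single-use functions between given sets have supports of bounded size. -/
theorem exists_card_support_le (𝔸 : Type*) [Nonempty 𝔸] (X Y : POF) :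
    ∃ N : ℕ, ∀ f : SingleUseFun 𝔸 X Y, ∃ S : Finset 𝔸, S.card ≤ N ∧
      MulAction.Supports (Equiv.Perm 𝔸) (S : Set 𝔸) f := by
  classical
  have := finite_el (α := Unit) X
  have := Fintype.ofFinite (El Unit X)
  -- The number of shapes times the bound for one decision tree.
  refine ⟨Fintype.card (El Unit X) * (2 ^ Fintype.card (Pos X) * (size Y + 2)), fun f => ?_⟩
  have key : ∀ c : El Unit X, ∃ S : Finset 𝔸,
      S.card ≤ 2 ^ Fintype.card (Pos X) * (size Y + 2) ∧
      ∀ (π : Equiv.Perm 𝔸) (ρ : Pos X → 𝔸), (∀ a ∈ S, π a = a) →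
        emap π Y (f.1 (eval ρ X (generic 𝔸 X c))) =
          f.1 (eval (π ∘ ρ) X (generic 𝔸 X c)) := fun c => by
    obtain ⟨S, hS, h⟩ := (f.2.decisionTree Finset.univ (generic 𝔸 X c)
      ((Multiset.le_iff_subset (nodup_vars_generic 𝔸 X c)).2
        fun v _ => Finset.mem_univ v)).exists_support
    exact ⟨S, (Nat.le_add_right _ 2).trans hS, h⟩
  choose S hS h using key
  refine ⟨Finset.univ.biUnion S, ?_, fun π hπ => Subtype.ext (funext fun x => ?_)⟩
  · exact Finset.card_biUnion_le_card_mul _ _ _ fun c _ => hS c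
  · change π • f.1 (π⁻¹ • x) = f.1 x
    have hπ' : ∀ c, ∀ a ∈ S c, π a = a := fun c a ha =>
      hπ (Finset.mem_coe.2 (Finset.mem_biUnion.2 ⟨c, Finset.mem_univ c, ha⟩))
    suffices H : ∀ y : El 𝔸 X, π • f.1 y = f.1 (π • y) by rw [H, smul_inv_smul]
    intro y
    obtain ⟨ρ, hρ⟩ := exists_eval_generic X y
    have hy := hρ (1 : Equiv.Perm 𝔸)
    rw [← smul_eq_emap, one_smul] at hy
    rw [smul_eq_emap, smul_eq_emap, ← hρ π, ← h _ π ρ (hπ' _)]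
    exact congrArg (fun z => emap π Y (f.1 z)) hy.symm

/-! ### Finitely many functions with a given support -/

/-- Finite sets of atoms can be moved into one another by a permutation that fixes a given finite
set disjoint from both of them. -/
theorem exists_perm_mapsTo {𝔸 : Type*} {S R W : Finset 𝔸} (hR : Disjoint R S)
    (hW : Disjoint W S) (h : R.card ≤ W.card) :
    ∃ π : Equiv.Perm 𝔸, (∀ a ∈ S, π a = a) ∧ ∀ a ∈ R, π a ∈ W := by
  classical
  obtain ⟨W', hW', hc⟩ := Finset.exists_subset_card_eq h
  -- A bijection between equinumerous subsets of a finite set extends to a permutation of that set,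
  -- and then by the identity outside it.
  have e : {x : ↥(R ∪ W') // x.1 ∈ R} ≃ {x : ↥(R ∪ W') // x.1 ∈ W'} :=
    Fintype.equivOfCardEq (by
      have key (Q : Finset 𝔸) (hQ : Q ⊆ R ∪ W') :
          Fintype.card {x : ↥(R ∪ W') // x.1 ∈ Q} = Q.card := by
        rw [← Fintype.card_coe]
        exact Fintype.card_congr (Equiv.subtypeSubtypeEquivSubtype fun h => hQ h)
      rw [key R Finset.subset_union_left, key W' Finset.subset_union_right, hc])
  refine ⟨Equiv.Perm.ofSubtype e.extendSubtype, fun a ha => ?_, fun a ha => ?_⟩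
  · refine Equiv.Perm.ofSubtype_apply_of_not_mem _ fun h => ?_
    rcases Finset.mem_union.1 h with h | h
    · exact Finset.disjoint_left.1 hR h ha
    · exact Finset.disjoint_left.1 hW (hW' h) ha
  · have ha' : a ∈ R ∪ W' := Finset.mem_union_left _ ha
    rw [Equiv.Perm.ofSubtype_apply_of_mem _ ha']
    exact hW' (e.extendSubtype_mem ⟨a, ha'⟩ ha)

/-- `R` consists of the atoms occurring in `x`; the range is the set of elements whose atoms all lie
in `W`. -/
theorem exists_finset_emap_mem_range {𝔸 : Type*} :
    ∀ (X : POF) (x : El 𝔸 X), ∃ R : Finset 𝔸, R.card ≤ size X ∧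
      ∀ (f : 𝔸 → 𝔸) (W : Set 𝔸), (∀ a ∈ R, f a ∈ W) →
        emap f X x ∈ Set.range (emap (Subtype.val : W → 𝔸) X)
  | one, _ => ⟨∅, by simp, fun _ _ _ => ⟨PUnit.unit, rfl⟩⟩
  | atom, a => ⟨{(a : 𝔸)}, (Finset.card_singleton (a : 𝔸)).le,
      fun f _ h => ⟨⟨f a, h a (Finset.mem_singleton_self (a : 𝔸))⟩, rfl⟩⟩
  | prod X Y, (x, y) => by
    classical
    obtain ⟨S, hS, hx⟩ := exists_finset_emap_mem_range X x
    obtain ⟨T, hT, hy⟩ := exists_finset_emap_mem_range Y y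
    refine ⟨S ∪ T, (Finset.card_union_le S T).trans (add_le_add hS hT), fun f W h => ?_⟩
    obtain ⟨x', hx'⟩ := hx f W fun a ha => h a (Finset.mem_union_left _ ha)
    obtain ⟨y', hy'⟩ := hy f W fun a ha => h a (Finset.mem_union_right _ ha)
    exact ⟨(x', y'), Prod.ext hx' hy'⟩
  | sum X Y, Sum.inl x => by
    obtain ⟨S, hS, hx⟩ := exists_finset_emap_mem_range X x
    refine ⟨S, hS.trans (Nat.le_add_right _ _), fun f W h => ?_⟩
    obtain ⟨x', hx'⟩ := hx f W h
    exact ⟨Sum.inl x', congrArg Sum.inl hx'⟩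
  | sum X Y, Sum.inr y => by
    obtain ⟨S, hS, hy⟩ := exists_finset_emap_mem_range Y y
    refine ⟨S, hS.trans (Nat.le_add_left _ _), fun f W h => ?_⟩
    obtain ⟨y', hy'⟩ := hy f W h
    exact ⟨Sum.inr y', congrArg Sum.inr hy'⟩

/-- Up to permutations fixing a given finite set of atoms, a polynomial orbit-finite set has only
finitely many elements. -/
theorem exists_finite_representatives {𝔸 : Type*} [Infinite 𝔸] (S : Finset 𝔸) (X : POF) :
    ∃ T : Set (El 𝔸 X), T.Finite ∧
      ∀ x, ∃ π : Equiv.Perm 𝔸, (∀ a ∈ S, π a = a) ∧ π • x ∈ T := by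
  classical
  -- Outside `S` there must be room for all atoms of an element.
  obtain ⟨W, hSW, hW⟩ := Infinite.exists_superset_card_eq S (S.card + size X)
    (Nat.le_add_right _ _)
  have := finite_el (α := ↥(W : Set 𝔸)) X
  refine ⟨Set.range (emap (Subtype.val : ↥(W : Set 𝔸) → 𝔸) X), Set.finite_range _, fun x => ?_⟩
  obtain ⟨R, hR, hx⟩ := exists_finset_emap_mem_range X x
  obtain ⟨π, hπS, hπR⟩ := exists_perm_mapsTo (S := S) (R := R \ S) (W := W \ S)
    Finset.sdiff_disjoint Finset.sdiff_disjoint (by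
      rw [Finset.card_sdiff_of_subset hSW, hW, Nat.add_sub_cancel_left]
      exact (Finset.card_le_card Finset.sdiff_subset).trans hR)
  refine ⟨π, hπS, ?_⟩
  rw [smul_eq_emap]
  refine hx π W fun a ha => Finset.mem_coe.2 ?_
  by_cases haS : a ∈ S
  · rw [hπS a haS]
    exact hSW haS
  · exact (Finset.mem_sdiff.1 (hπR a (Finset.mem_sdiff.2 ⟨ha, haS⟩))).1

/-- Only finitely many functions are supported by a given finite set of atoms. -/
theorem finite_setOf_supports {𝔸 : Type*} [Infinite 𝔸] (S : Finset 𝔸) (X Y : POF) :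
    {f : SingleUseFun 𝔸 X Y | MulAction.Supports (Equiv.Perm 𝔸) (S : Set 𝔸) f}.Finite := by
  obtain ⟨T, hT, h⟩ := exists_finite_representatives S (prod X Y)
  -- The graph of a function supported by `S` is invariant under permutations fixing `S`, so its
  -- trace on the finite set `T` determines it.
  let graph (f : SingleUseFun 𝔸 X Y) : Set (El 𝔸 X × El 𝔸 Y) := {p ∈ T | p.2 = f.1 p.1}
  refine Set.Finite.of_finite_image (f := graph)
    (hT.finite_subsets.subset ?_) fun f hf g hg hfg => Subtype.ext (funext fun x => ?_)
  · rintro _ ⟨f, -, rfl⟩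
    exact Set.sep_subset _ _
  · have equivariant {f : SingleUseFun 𝔸 X Y}
        (hf : MulAction.Supports (Equiv.Perm 𝔸) (S : Set 𝔸) f) {π : Equiv.Perm 𝔸}
        (hπ : ∀ a ∈ S, π a = a) (x : El 𝔸 X) : f.1 (π • x) = π • f.1 x := by
      have h : π • f.1 (π⁻¹ • π • x) = f.1 (π • x) :=
        congrFun (congrArg Subtype.val (hf π fun a ha => hπ a ha)) (π • x)
      rw [← h, inv_smul_smul]
    obtain ⟨π, hπ, hx⟩ := h (x, f.1 x)
    have hmem : (π • x, π • f.1 x) ∈ graph f := ⟨hx, (equivariant hf hπ x).symm⟩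
    rw [hfg] at hmem
    have := hmem.2
    rw [equivariant hg hπ] at this
    exact smul_left_cancel π this

end POF

/-! ### Counting orbits -/

theorem mainTheorem7 (𝔸 : Type*) [Countable 𝔸] [Infinite 𝔸] (X Y : POF) :
    IsOrbitFinite 𝔸 (POF.SingleUseFun 𝔸 X Y) := by
  obtain ⟨N, hN⟩ := POF.exists_card_support_le 𝔸 X Y
  refine ⟨fun f => ?_, ?_⟩
  · obtain ⟨S, -, hS⟩ := hN f
    exact ⟨S, hS⟩
  obtain ⟨W, hW⟩ := Infinite.exists_subset_card_eq 𝔸 N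
  have := (POF.finite_setOf_supports W X Y).to_subtype
  refine Finite.of_surjective
    (fun f : {f : POF.SingleUseFun 𝔸 X Y | MulAction.Supports (Equiv.Perm 𝔸) (W : Set 𝔸) f} =>
      (Quotient.mk _ f.1 : MulAction.orbitRel.Quotient (Equiv.Perm 𝔸) _)) ?_
  refine Quotient.ind fun f => ?_
  obtain ⟨S, hS, hf⟩ := hN f
  obtain ⟨π, -, hπ⟩ := POF.exists_perm_mapsTo (S := ∅) (Finset.disjoint_empty_right S)
    (Finset.disjoint_empty_right W) (hS.trans hW.ge)
  refine ⟨⟨π • f, fun σ hσ => ?_⟩, Quotient.sound ⟨π, rfl⟩⟩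
  -- Since `π` maps `S` into `W`, conjugating a permutation that fixes `W` gives one that fixes `S`.
  have h : (π⁻¹ * σ * π) • f = f := hf _ fun a ha => by
    have := hσ (Finset.mem_coe.2 (hπ a ha))
    change π⁻¹ (σ (π a)) = a
    rw [show σ (π a) = π a from this]
    exact π.symm_apply_apply a
  calc σ • π • f = π • (π⁻¹ * σ * π) • f := by
        simp only [← mul_smul, mul_assoc, mul_inv_cancel_left]
    _ = π • f := by rw [h]
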